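/- **Conventions.** All von Neumann algebras are taken up to $*$-isomorphism, i.e. as $W^*$-algebras ($C^*$-algebras with a Banach space predual). A map between von Neumann algebras is *normal* if it preserves suprema of bounded directed sets of self-adjoint elements. An *NCP-map* is a normal completely positive linear map; an *NMIU-map* is a normal unital $*$-homomorphism; an *NMIU-isomorphism* is a bijective NMIU-map whose inverse is an NMIU-map. A *Paschke dilation* of an NCP-map $\varphi\colon\mathscr A\to\mathscr B$ between von Neumann algebras is a pair $\mathscr A\xrightarrow{\varrho}\mathscr P\xrightarrow{f}\mathscr B$, where $\mathscr P$ is a von Neumann algebra, $\varrho$ is an NMIU-map and $f$ is an NCP-map with $\varphi=f\circ\varrho$, such that for every other such pair $\mathscr A\xrightarrow{\varrho'}\mathscr P'\xrightarrow{f'}\mathscr B$ (with $\mathscr P'$ a von Neumann algebra, $\varrho'$ an NMIU-map, $f'$ an NCP-map and $\varphi=f'\circ\varrho'$) there is a unique NCP-map $\sigma\colon\mathscr P'\to\mathscr P$ with $\sigma\circ\varrho'=\varrho$ and $f\circ\sigma=f'$. For a bounded operator $V\colon\mathscr H\to\mathscr K$ between Hilbert spaces, $\operatorname{Ad}_V\colon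 B(\mathscr K)\to B(\mathscr H)$ is the map $\operatorname{Ad}_V(T)=V^*TV$. A *normal Stinespring dilation* of $\varphi\colon\mathscr A\to B(\mathscr H)$ is a triple $(\mathscr K,\pi,V)$ with $\mathscr K$ a Hilbert space, $\pi\colon\mathscr A\to B(\mathscr K)$ an NMIU-map and $V\colon\mathscr H\to\mathscr K$ a bounded operator such that $\varphi=\operatorname{Ad}_V\circ\pi$. It is *minimal* if the linear span of $\{\pi(a)Vx : a\in\mathscr A,\ x\in\mathscr H\}$ is dense in $\mathscr K$. **Theorem.** Let $\mathscr A$ be a von Neumann algebra, $\mathscr H$ a complex Hilbert space, $\varphi\colon\mathscr A\to B(\mathscr H)$ an NCP-map, and $(\mathscr K,\pi,V)$ a minimal normal Stinespring dilation of $\varphi$. Then 1. $\mathscr A\xrightarrow{\pi}B(\mathscr K)\xrightarrow{\operatorname{Ad}_V}B(\mathscr H)$ is a Paschke dilation of $\varphi$; 2. for every Paschke dilation $\mathscr A\xrightarrow{\varrho}\mathscr P\xrightarrow{f}B(\mathscr H)$ of $\varphi$ there is a unique NMIU-isomorphism $\vartheta\colon B(\mathscr K)\to\mathscr P$ with $\varrho=\vartheta\circ\pi$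 and $f\circ\vartheta=\operatorname{Ad}_V$. -/

import Mathlib

/-! ### `B(H)` is a W⋆-algebra -/

section Predual

open InnerProductSpace

variable {H : Type*} [NormedAddCommGroup H] [InnerProductSpace ℂ H] [CompleteSpace H]

/-- The vector functional `T ↦ ⟪x, T y⟫` on `B(H)`. -/
noncomputable def vectorFunctional (x y : H) : StrongDual ℂ (H →L[ℂ] H) :=
  (innerSL ℂ x).comp (ContinuousLinearMap.apply ℂ H y)

theorem vectorFunctional_apply (x y : H) (T : H →L[ℂ] H) :
    vectorFunctional x y T = inner ℂ x (T y) := rfl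

theorem norm_vectorFunctional_le (x y : H) : ‖vectorFunctional x y‖ ≤ ‖x‖ * ‖y‖ := by
  refine ContinuousLinearMap.opNorm_le_bound _ (by positivity) fun T => ?_
  rw [vectorFunctional_apply]
  calc ‖inner ℂ x (T y)‖ ≤ ‖x‖ * ‖T y‖ := norm_inner_le_norm _ _
    _ ≤ ‖x‖ * (‖T‖ * ‖y‖) := by gcongr; exact T.le_opNorm y
    _ = ‖x‖ * ‖y‖ * ‖T‖ := by ring

theorem nonempty_strongDual_equiv {X : Type*} [NormedAddCommGroup X] [NormedSpace ℂ X]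
    (ι : X →ₗᵢ[ℂ] StrongDual ℂ (H →L[ℂ] H)) (v : H → H → X)
    (hv : ∀ x y, ι (v x y) = vectorFunctional x y)
    (hd : Dense (Submodule.span ℂ (Set.range fun p : H × H => v p.1 p.2) : Set X)) :
    Nonempty (StrongDual ℂ X ≃ₗᵢ⋆[ℂ] (H →L[ℂ] H)) := by
  have hn : ∀ x y, ‖v x y‖ ≤ ‖x‖ * ‖y‖ := fun x y => by
    rw [← ι.norm_map, hv]; exact norm_vectorFunctional_le x y
  let e : (H →L[ℂ] H) → StrongDual ℂ X := fun T =>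
    (ContinuousLinearMap.apply ℂ ℂ (star T)).comp ι.toContinuousLinearMap
  have he : ∀ T ω, e T ω = ι ω (star T) := fun _ _ => rfl
  have hev : ∀ T x y, e T (v x y) = inner ℂ (T x) y := fun T x y => by
    rw [he, hv, vectorFunctional_apply, ContinuousLinearMap.star_eq_adjoint,
      ContinuousLinearMap.adjoint_inner_right]
  have hnorm : ∀ T, ‖e T‖ = ‖T‖ := by
    intro T
    apply le_antisymm
    · refine ContinuousLinearMap.opNorm_le_bound _ (norm_nonneg _) fun ω => ?_
      rw [he, mul_comm, ← norm_star T, ← ι.norm_map]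
      exact (ι ω).le_opNorm _
    · refine ContinuousLinearMap.opNorm_le_bound _ (norm_nonneg _) fun x => ?_
      have h := (e T).le_opNorm (v x (T x))
      rw [hev, inner_self_eq_norm_sq_to_K, norm_pow, RCLike.norm_ofReal, abs_norm] at h
      have h3 : ‖T x‖ * ‖T x‖ ≤ (‖e T‖ * ‖x‖) * ‖T x‖ := by
        calc ‖T x‖ * ‖T x‖ = ‖T x‖ ^ 2 := by ring
          _ ≤ ‖e T‖ * (‖x‖ * ‖T x‖) :=
            h.trans (mul_le_mul_of_nonneg_left (hn _ _) (norm_nonneg _))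
          _ = _ := by ring
      rcases (norm_nonneg (T x)).eq_or_lt with h0 | h0
      · rw [← h0]; positivity
      · exact le_of_mul_le_mul_right h3 h0
  have hsurj : Function.Surjective e := by
    intro F
    let B₀ : H →ₛₗ[starRingEnd ℂ] H →ₗ[ℂ] ℂ :=
      LinearMap.mk₂'ₛₗ (starRingEnd ℂ) (RingHom.id ℂ) (fun x y => F (v x y))
        (fun x₁ x₂ y => by
          rw [← map_add]; congr 1; apply ι.injective; ext T
          simp [hv, vectorFunctional_apply])
        (fun c x y => by
          rw [← map_smul]; congr 1; apply ι.injective; ext T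
          simp [hv, vectorFunctional_apply, mul_comm])
        (fun x y₁ y₂ => by
          rw [← map_add]; congr 1; apply ι.injective; ext T
          simp [hv, vectorFunctional_apply])
        (fun c x y => by
          rw [RingHom.id_apply, ← map_smul]; congr 1; apply ι.injective; ext T
          simp [hv, vectorFunctional_apply])
    let B : H →L⋆[ℂ] H →L[ℂ] ℂ := LinearMap.mkContinuous₂ B₀ ‖F‖ fun x y => by
      calc _ ≤ _ := F.le_opNorm (v x y)
        _ ≤ ‖F‖ * (‖x‖ * ‖y‖) := mul_le_mul_of_nonneg_left (hn x y) (norm_nonneg _)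
        _ = _ := by ring
    refine ⟨continuousLinearMapOfBilin B, ?_⟩
    refine ContinuousLinearMap.ext_on hd ?_
    rintro _ ⟨⟨x, y⟩, rfl⟩
    simp only [hev, continuousLinearMapOfBilin_apply]
    rfl
  let Ψ : (H →L[ℂ] H) →ₗᵢ⋆[ℂ] StrongDual ℂ X :=
    { toFun := e
      map_add' := fun S T => by ext ω; simp [he]
      map_smul' := fun c T => by ext ω; simp [he]
      norm_map' := hnorm }
  exact ⟨(LinearIsometryEquiv.ofSurjective Ψ hsurj).symm⟩

/-- The algebra of bounded operators on a Hilbert space is a W⋆-algebra; a predual is the closed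
linear span of the vector functionals. -/
instance instWStarAlgebraBoundedOperators : WStarAlgebra (H →L[ℂ] H) where
  exists_predual := by
    let S : Submodule ℂ (StrongDual ℂ (H →L[ℂ] H)) :=
      Submodule.span ℂ (Set.range fun p : H × H => vectorFunctional p.1 p.2)
    let X := S.topologicalClosure
    have hX : IsClosed (X : Set (StrongDual ℂ (H →L[ℂ] H))) := S.isClosed_topologicalClosure
    have hmem : ∀ x y, vectorFunctional x y ∈ X := fun x y =>
      S.le_topologicalClosure (Submodule.subset_span ⟨(x, y), rfl⟩)
    refine ⟨X, inferInstance, inferInstance, hX.completeSpace_coe,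
      nonempty_strongDual_equiv X.subtypeₗᵢ (fun x y => ⟨_, hmem x y⟩) (fun _ _ => rfl) ?_⟩
    rw [Subtype.dense_iff]
    intro ω hω
    have himg : ((↑) : X → StrongDual ℂ (H →L[ℂ] H)) '' (Submodule.span ℂ
        (Set.range fun p : H × H => (⟨_, hmem p.1 p.2⟩ : X)) : Set X) = S := by
      change ((X.subtype '' _ : Set _)) = _
      rw [← Submodule.map_coe, Submodule.map_span, ← Set.range_comp]
      rfl
    exact (congrArg (fun s => ω ∈ closure s) himg).mpr hω

end Predual

/-! ### NCP-maps and Paschke dilations -/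

/-- NCP-maps: normal completely positive linear maps. `ScottContinuous f` says that `f` preserves
suprema of directed sets; two comparable elements differ by a selfadjoint (indeed positive) one, so
for a linear `f` this is the usual normality condition on bounded directed sets of selfadjoint
elements. -/
structure IsNCP {A B : Type*} [CStarAlgebra A] [PartialOrder A] [StarOrderedRing A]
    [CStarAlgebra B] [PartialOrder B] [StarOrderedRing B] (f : A →ₗ[ℂ] B) : Prop where
  completelyPositive : ∃ g : CompletelyPositiveMap A B, g.toLinearMap = f
  normal : ScottContinuous f

/-- NMIU-maps: normal unital `⋆`-homomorphisms. -/
def IsNMIU {A B : Type*} [CStarAlgebra A] [PartialOrder A]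
    [CStarAlgebra B] [PartialOrder B] (ρ : A →⋆ₐ[ℂ] B) : Prop :=
  ScottContinuous ρ

/-- `A --ρ--> P --f--> B` is a Paschke dilation of `φ : A → B`. The von Neumann algebras `P'`
against which it is tested range over the universe `w`. -/
structure IsPaschkeDilation.{w, u₁, u₂, u₃} {A : Type u₁} {B : Type u₂} {P : Type u₃}
    [CStarAlgebra A] [PartialOrder A] [StarOrderedRing A] [WStarAlgebra A]
    [CStarAlgebra B] [PartialOrder B] [StarOrderedRing B] [WStarAlgebra B]
    [CStarAlgebra P] [PartialOrder P] [StarOrderedRing P] [WStarAlgebra P]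
    (φ : A →ₗ[ℂ] B) (ρ : A →⋆ₐ[ℂ] P) (f : P →ₗ[ℂ] B) : Prop where
  nmiu : IsNMIU ρ
  ncp : IsNCP f
  factor : ∀ a, φ a = f (ρ a)
  universal : ∀ (P' : Type w) [CStarAlgebra P'] [PartialOrder P'] [StarOrderedRing P']
    [WStarAlgebra P'] (ρ' : A →⋆ₐ[ℂ] P') (f' : P' →ₗ[ℂ] B),
    IsNMIU ρ' → IsNCP f' → (∀ a, φ a = f' (ρ' a)) →
      ∃! σ : P' →ₗ[ℂ] P, IsNCP σ ∧ (∀ a, σ (ρ' a) = ρ a) ∧ ∀ c, f (σ c) = f' c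

/-! ### Stinespring dilations -/

section Stinespring

variable {H K : Type*} [NormedAddCommGroup H] [InnerProductSpace ℂ H] [CompleteSpace H]
  [NormedAddCommGroup K] [InnerProductSpace ℂ K] [CompleteSpace K]

/-- `Ad_V : B(K) → B(H)`, `T ↦ V⋆ T V`, for a bounded operator `V : H → K`. -/
noncomputable def Ad (V : H →L[ℂ] K) : (K →L[ℂ] K) →ₗ[ℂ] (H →L[ℂ] H) where
  toFun T := (ContinuousLinearMap.adjoint V).comp (T.comp V)
  map_add' S T := by ext x; simp
  map_smul' c T := by ext x; simp

/-- `(K, π, V)` is a normal Stinespring dilation of `φ : A → B(H)`. -/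
structure IsNormalStinespringDilation {A : Type*} [CStarAlgebra A] [PartialOrder A]
    (φ : A →ₗ[ℂ] (H →L[ℂ] H)) (π : A →⋆ₐ[ℂ] (K →L[ℂ] K)) (V : H →L[ℂ] K) : Prop where
  nmiu : IsNMIU π
  factor : ∀ a, φ a = Ad V (π a)

/-- A normal Stinespring dilation is minimal if the linear span of the vectors `π(a) V x`
is dense in `K`. -/
structure IsMinimalNormalStinespringDilation {A : Type*} [CStarAlgebra A] [PartialOrder A]
    (φ : A →ₗ[ℂ] (H →L[ℂ] H)) (π : A →⋆ₐ[ℂ] (K →L[ℂ] K)) (V : H →L[ℂ] K) : Prop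
    extends IsNormalStinespringDilation φ π V where
  dense_span : Dense (Submodule.span ℂ {y : K | ∃ (a : A) (x : H), y = π a (V x)} : Set K)

end Stinespring

universe w u₁ u₂ u₃

open InnerProductSpace

/-! ### Positivity of matrices over a C⋆-algebra -/

section Matrices

variable {A B : Type*} [CStarAlgebra A] [PartialOrder A] [StarOrderedRing A]
  [CStarAlgebra B] [PartialOrder B] [StarOrderedRing B]

/-! Existence of mediating maps: given a factorisation φ = f ∘ ρ through P, form the Stinespring
space L of f, spanned by vectors k(a)x with inner products ⟨k(a)x, k(b)y⟩ = ⟨x, f(a⋆b)y⟩, on which P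
acts by left multiplication τ. The families π(a)Vx in K and k(ρ(a))x in L have the same Gram matrix
⟨x, φ(a⋆b)y⟩, so minimality yields a bounded S : K → L carrying one to the other, and σ = Ad_S ∘ τ
mediates (`exists_mediating`).

Uniqueness of mediating maps: any such σ is unital and completely positive, and σ ∘ ρ is the
homomorphism π, so ρ(A) lies in the multiplicative domain of σ. Hence ⟨π(a)Vx, σ(c)π(b)Vy⟩ = ⟨x,
f(ρ(a⋆)cρ(b))y⟩, which determines σ on a total family (`inner_mediating`).

Normality is the analytic part. For Ad_V it follows from Vigier's theorem; for τ it reduces to the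
vector functionals of c ↦ f(b⋆cb), treated in `exists_re_inner_conj_lt`.

Finally, two Paschke dilations give mutually inverse unital completely positive maps, and
Kadison–Schwarz in both directions makes these multiplicative. -/

theorem CStarAlgebra.exists_eq_star_mul_self {a : A} (ha : 0 ≤ a) :
    ∃ b, a = star b * b :=
  CStarAlgebra.nonneg_iff_eq_star_mul_self.mp ha

/-- The witness is the negative part, orthogonal to the positive part; only these three properties
are needed to test positivity of matrices. -/
theorem IsSelfAdjoint.exists_negPart {a : A} (ha : IsSelfAdjoint a) :
    ∃ d : A, 0 ≤ d ∧ d * a * d = -(d * d * d) ∧ (d = 0 → 0 ≤ a) := by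
  refine ⟨a⁻, CFC.negPart_nonneg a, ?_, fun h => ?_⟩
  · nth_rw 2 [← CFC.posPart_sub_negPart a ha]
    rw [mul_sub, CFC.negPart_mul_posPart, zero_sub, neg_mul]
  · rw [← CFC.posPart_sub_negPart a ha, h, sub_zero]
    exact CFC.posPart_nonneg a

theorem CStarMatrix.nonneg_of_forall_sum_nonneg {n : Type*} [Fintype n] [DecidableEq n]
    {M : CStarMatrix n n A} (hsa : IsSelfAdjoint M)
    (h : ∀ y : n → A, 0 ≤ ∑ i, ∑ j, star (y i) * M i j * y j) : 0 ≤ M := by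
  obtain ⟨D, hD, hDMD, hM⟩ := hsa.exists_negPart
  have hDsa : star D = D := (IsSelfAdjoint.of_nonneg hD).star_eq
  have hcube : 0 ≤ D * D * D := by
    have := star_left_conjugate_nonneg hD D
    rwa [hDsa] at this
  obtain ⟨E, hE⟩ := CStarAlgebra.exists_eq_star_mul_self hcube
  have hE0 : E = 0 := by
    ext k i
    -- With column i of D as test vector, the sum is the (i, i) entry of D M D = -E⋆E, so positivity
    -- kills column i of E.
    have h1 := h fun j => D j i
    have h2 : ∑ j, ∑ l, star (D j i) * M j l * D l i = -∑ k, star (E k i) * E k i := by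
      have h3 : (D * M * D) i i = (-(star E * E)) i i := by rw [hDMD, hE]
      rw [CStarMatrix.neg_apply, CStarMatrix.mul_apply, CStarMatrix.mul_apply] at h3
      simp only [CStarMatrix.mul_apply, Finset.sum_mul, CStarMatrix.star_apply] at h3
      rw [← h3, Finset.sum_comm]
      refine Finset.sum_congr rfl fun j _ => Finset.sum_congr rfl fun l _ => ?_
      rw [← CStarMatrix.star_apply, hDsa]
    rw [h2, neg_nonneg] at h1
    have h4 : star (E k i) * E k i ≤ 0 :=
      (Finset.single_le_sum (f := fun k => star (E k i) * E k i)
        (fun k _ => star_mul_self_nonneg (E k i)) (Finset.mem_univ k)).trans h1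
    exact (CStarRing.star_mul_self_eq_zero_iff _).mp (h4.antisymm (star_mul_self_nonneg _))
  have h3 : D * D * D = 0 := by rw [hE, hE0, mul_zero]
  have h2 : D * D = 0 := by
    rw [← CStarRing.star_mul_self_eq_zero_iff, star_mul, hDsa, ← mul_assoc, h3, zero_mul]
  refine hM ?_
  rw [← CStarRing.star_mul_self_eq_zero_iff, hDsa, h2]

/-- The matrix `(f (xᵢ⋆ xⱼ))` of a completely positive map is a Gram matrix. -/
theorem CompletelyPositiveMap.exists_gram (f : CompletelyPositiveMap A B)
    {n : Type*} [Fintype n] [DecidableEq n] (x : n → A) :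
    ∃ N : CStarMatrix n n B, ∀ i j, f (star (x i) * x j) = ∑ k, star (N k i) * N k j := by
  cases isEmpty_or_nonempty n with
  | inl h => exact ⟨0, fun i => h.elim i⟩
  | inr h =>
    obtain ⟨k₀⟩ := h
    -- Only row k₀ of R is nonzero, and it lists the xᵢ; thus R⋆R has entries xᵢ⋆xⱼ.
    let R : CStarMatrix n n A := CStarMatrix.ofMatrix fun k i => if k = k₀ then x i else 0
    have hR' : ∀ k i, R k i = if k = k₀ then x i else 0 := fun _ _ => rfl
    have hR : ∀ i j, (star R * R) i j = star (x i) * x j := fun i j => by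
      simp only [CStarMatrix.mul_apply, CStarMatrix.star_apply]
      rw [Finset.sum_eq_single k₀]
      · simp only [hR', if_true]
      · intro b _ hb
        simp only [hR', if_neg hb, mul_zero]
      · simp
    obtain ⟨N, hN⟩ := CStarAlgebra.exists_eq_star_mul_self
      (f.map_cstarMatrix_nonneg _ (star_mul_self_nonneg R))
    refine ⟨N, fun i j => ?_⟩
    rw [← hR, ← CStarMatrix.map_apply (f := f), hN, CStarMatrix.mul_apply]
    simp only [CStarMatrix.star_apply]

/-- The Kadison–Schwarz inequality. -/
theorem CompletelyPositiveMap.star_map_mul_map_le (f : CompletelyPositiveMap A B) (hf : f 1 = 1)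
    (b : A) : star (f b) * f b ≤ f (star b * b) := by
  obtain ⟨N, hN⟩ := f.exists_gram ![1, b]
  have h00 := hN 0 0
  have h01 := hN 0 1
  have h10 := hN 1 0
  have h11 := hN 1 1
  simp only [Fin.sum_univ_two, Matrix.cons_val_zero, Matrix.cons_val_one, star_one, one_mul,
    mul_one, hf, map_star] at h00 h01 h10 h11
  rw [← sub_nonneg]
  -- A Schur complement: column 0 of N has Gram square f 1 = 1, and its component is subtracted from
  -- column 1.
  have key : f (star b * b) - star (f b) * f b =
      ∑ k, star (N k 1 - N k 0 * f b) * (N k 1 - N k 0 * f b) := by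
    have e : ∀ k, star (N k 1 - N k 0 * f b) * (N k 1 - N k 0 * f b) =
        star (N k 1) * N k 1 - star (N k 1) * N k 0 * f b - star (f b) * (star (N k 0) * N k 1)
          + star (f b) * (star (N k 0) * N k 0) * f b := fun k => by
      simp only [star_sub, star_mul]; noncomm_ring
    rw [Fin.sum_univ_two, e, e]
    have : star (f b) * 1 * f b = star (f b) * (star (N 0 0) * N 0 0 + star (N 1 0) * N 1 0) * f b :=
      by rw [← h00]
    have h2 : star (f b) * f b = (star (N 0 1) * N 0 0 + star (N 1 1) * N 1 0) * f b := by
      rw [← h10]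
    have h3 : star (f b) * f b = star (f b) * (star (N 0 0) * N 0 1 + star (N 1 0) * N 1 1) := by
      rw [← h01]
    calc f (star b * b) - star (f b) * f b
        = f (star b * b) - star (f b) * f b - star (f b) * f b + star (f b) * 1 * f b := by
          rw [mul_one]; abel
      _ = _ := by
          rw [this, h11]; nth_rw 1 [h2]; rw [h3]; noncomm_ring
  rw [key]
  exact Finset.sum_nonneg fun k _ => star_mul_self_nonneg _

end Matrices

/-! ### Operators on Hilbert spaces: order and normality -/

section Operators

variable {H K : Type*} [NormedAddCommGroup H] [InnerProductSpace ℂ H] [CompleteSpace H]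
  [NormedAddCommGroup K] [InnerProductSpace ℂ K] [CompleteSpace K]

theorem Ad_apply_apply (V : H →L[ℂ] K) (T : K →L[ℂ] K) (x : H) :
    Ad V T x = ContinuousLinearMap.adjoint V (T (V x)) := rfl

theorem inner_Ad (V : H →L[ℂ] K) (T : K →L[ℂ] K) (x y : H) :
    inner ℂ x (Ad V T y) = inner ℂ (V x) (T (V y)) := by
  rw [Ad_apply_apply, ContinuousLinearMap.adjoint_inner_right]

theorem star_Ad (V : H →L[ℂ] K) (T : K →L[ℂ] K) : star (Ad V T) = Ad V (star T) := by
  refine ContinuousLinearMap.ext fun x => ext_inner_left ℂ fun y => ?_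
  rw [ContinuousLinearMap.star_eq_adjoint, ContinuousLinearMap.adjoint_inner_right, inner_Ad,
    ContinuousLinearMap.star_eq_adjoint, ContinuousLinearMap.adjoint_inner_right,
    ← inner_conj_symm, inner_Ad, inner_conj_symm]

/-- For a matrix N⋆N the quadratic form at y is ∑ₗ Zₗ⋆Zₗ with Zₗ = ∑ⱼ Nₗⱼ V yⱼ. -/
theorem exists_completelyPositiveMap_Ad (V : H →L[ℂ] K) :
    ∃ g : CompletelyPositiveMap (K →L[ℂ] K) (H →L[ℂ] H), g.toLinearMap = Ad V := by
  refine ⟨⟨Ad V, fun k M hM => ?_⟩, rfl⟩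
  refine CStarMatrix.nonneg_of_forall_sum_nonneg ?_ fun y => ?_
  · ext1 i j
    rw [CStarMatrix.star_apply]
    change star (Ad V (M j i)) = Ad V (M i j)
    rw [star_Ad, ← CStarMatrix.star_apply, (IsSelfAdjoint.of_nonneg hM).star_eq]
  · obtain ⟨N, rfl⟩ := CStarAlgebra.exists_eq_star_mul_self hM
    let Z : Fin k → H →L[ℂ] K := fun l => ∑ j, (N l j).comp (V.comp (y j))
    have : ∑ i, ∑ j, star (y i) * (star N * N).map (Ad V) i j * y j =
        ∑ l, (ContinuousLinearMap.adjoint (Z l)).comp (Z l) := by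
      refine ContinuousLinearMap.ext fun x => ext_inner_left ℂ fun w => ?_
      simp only [sum_apply, inner_sum, mul_apply_eq_comp,
        ContinuousLinearMap.star_eq_adjoint, ContinuousLinearMap.adjoint_inner_right,
        CStarMatrix.map_apply, inner_Ad, CStarMatrix.mul_apply, CStarMatrix.star_apply,
        ContinuousLinearMap.comp_apply, Z, sum_inner]
      calc _ = ∑ i, ∑ l, ∑ j, inner ℂ (N l i (V (y i w))) (N l j (V (y j x))) :=
            Finset.sum_congr rfl fun i _ => Finset.sum_comm
        _ = _ := Finset.sum_comm
        _ = _ := Finset.sum_congr rfl fun i _ => Finset.sum_comm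
    change 0 ≤ ∑ i, ∑ j, star (y i) * (star N * N).map (Ad V) i j * y j
    rw [this]
    refine Finset.sum_nonneg fun l _ => ?_
    rw [ContinuousLinearMap.nonneg_iff_isPositive]
    exact ContinuousLinearMap.isPositive_adjoint_comp_self _

theorem ContinuousLinearMap.le_iff_forall_inner {S T : H →L[ℂ] H} (hsa : IsSelfAdjoint (T - S)) :
    S ≤ T ↔ ∀ x, 0 ≤ (inner ℂ x ((T - S) x)).re := by
  rw [ContinuousLinearMap.le_def, ContinuousLinearMap.isPositive_def']
  simp only [hsa, true_and, ContinuousLinearMap.reApplyInnerSelf_apply]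
  refine forall_congr' fun x => ?_
  rw [← inner_conj_symm, RCLike.conj_re]
  rfl

theorem re_inner_apply_nonneg {T : H →L[ℂ] H} (hT : 0 ≤ T) (x : H) :
    0 ≤ (inner ℂ x (T x)).re := by
  simpa using (ContinuousLinearMap.le_iff_forall_inner (S := 0)
    (by simpa using IsSelfAdjoint.of_nonneg hT)).mp hT x

theorem re_inner_apply_mono {S T : H →L[ℂ] H} (h : S ≤ T) (x : H) :
    (inner ℂ x (S x)).re ≤ (inner ℂ x (T x)).re := by
  have := re_inner_apply_nonneg (sub_nonneg.mpr h) x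
  rw [sub_apply, inner_sub_right, Complex.sub_re] at this
  linarith

end Operators

/-! ### Suprema as weak limits, and criteria for normality. -/

section Vigier

variable {H : Type*} [NormedAddCommGroup H] [InnerProductSpace ℂ H] [CompleteSpace H]

/-- A family of operators bounded along an ultrafilter has a limit in the weak operator sense. -/
theorem exists_weak_limit {ι : Type*} (l : Ultrafilter ι) (D : ι → H →L[ℂ] H) (C : ℝ)
    (hC : ∀ᶠ i in (l : Filter ι), ‖D i‖ ≤ C) :
    ∃ R : H →L[ℂ] H, ∀ x y, Filter.Tendsto (fun i => inner ℂ x (D i y)) l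
      (nhds (inner ℂ x (R y))) := by
  have hC0 : 0 ≤ C := by
    obtain ⟨i, hi⟩ := hC.exists
    exact (norm_nonneg _).trans hi
  have hbd : ∀ x y, ∀ᶠ i in (l : Filter ι), inner ℂ (D i x) y ∈
      Metric.closedBall (0 : ℂ) (C * ‖x‖ * ‖y‖) := fun x y => by
    filter_upwards [hC] with i hi
    rw [mem_closedBall_zero_iff]
    calc ‖inner ℂ (D i x) y‖ ≤ ‖D i x‖ * ‖y‖ := norm_inner_le_norm _ _
      _ ≤ (‖D i‖ * ‖x‖) * ‖y‖ := by gcongr; exact (D i).le_opNorm x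
      _ ≤ C * ‖x‖ * ‖y‖ := by gcongr
  have hex : ∀ x y, ∃ z ∈ Metric.closedBall (0 : ℂ) (C * ‖x‖ * ‖y‖),
      Filter.Tendsto (fun i => inner ℂ (D i x) y) l (nhds z) := fun x y =>
    (isCompact_closedBall (0 : ℂ) (C * ‖x‖ * ‖y‖)).ultrafilter_le_nhds'
      (l.map fun i => inner ℂ (D i x) y) (hbd x y)
  choose B hB hlim using hex
  let B₀ : H →ₛₗ[starRingEnd ℂ] H →ₗ[ℂ] ℂ :=
    LinearMap.mk₂'ₛₗ (starRingEnd ℂ) (RingHom.id ℂ) B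
      (fun x₁ x₂ y => tendsto_nhds_unique (hlim _ _) <| by
        simpa only [map_add, inner_add_left] using (hlim x₁ y).add (hlim x₂ y))
      (fun c x y => tendsto_nhds_unique (hlim _ _) <| by
        simpa only [map_smul, inner_smul_left, smul_eq_mul] using (hlim x y).const_mul _)
      (fun x y₁ y₂ => tendsto_nhds_unique (hlim _ _) <| by
        simpa only [inner_add_right] using (hlim x y₁).add (hlim x y₂))
      (fun c x y => tendsto_nhds_unique (hlim _ _) <| by
        simpa only [inner_smul_right, RingHom.id_apply, smul_eq_mul] using (hlim x y).const_mul _)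
  let B₁ : H →L⋆[ℂ] H →L[ℂ] ℂ := LinearMap.mkContinuous₂ B₀ C fun x y => by
    have := hB x y
    rwa [mem_closedBall_zero_iff] at this
  refine ⟨continuousLinearMapOfBilin B₁, fun x y => ?_⟩
  have h := (hlim y x)
  have e : B y x = inner ℂ (continuousLinearMapOfBilin B₁ y) x := by
    rw [continuousLinearMapOfBilin_apply]; rfl
  rw [e] at h
  have h' := (Complex.continuous_conj.tendsto _).comp h
  rw [inner_conj_symm] at h'
  exact h'.congr fun i => inner_conj_symm _ _

/-- Vigier's theorem: the supremum of a directed set of operators is its weak limit. -/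
theorem exists_re_inner_sub_lt {d : Set (H →L[ℂ] H)} (hne : d.Nonempty)
    (hd : DirectedOn (· ≤ ·) d) {a : H →L[ℂ] H} (ha : IsLUB d a) (x : H) {ε : ℝ} (hε : 0 < ε) :
    ∃ c ∈ d, (inner ℂ x ((a - c) x)).re < ε := by
  have : Nonempty d := hne.to_subtype
  have : IsDirectedOrder d := ⟨fun p q => by
    obtain ⟨r, hr, h1, h2⟩ := hd p p.2 q q.2
    exact ⟨⟨r, hr⟩, h1, h2⟩⟩
  -- Past c₀ the differences a - c are norm bounded, so compactness gives a weak limit R along an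
  -- ultrafilter finer than `atTop`.
  let l : Ultrafilter d := Ultrafilter.of Filter.atTop
  have hl : (l : Filter d) ≤ Filter.atTop := Ultrafilter.of_le _
  obtain ⟨c₀⟩ := ‹Nonempty d›
  have hpos : ∀ c : d, 0 ≤ a - c := fun c => sub_nonneg.mpr (ha.1 c.2)
  obtain ⟨R, hR⟩ := exists_weak_limit l (fun c => a - (c : H →L[ℂ] H)) ‖a - (c₀ : H →L[ℂ] H)‖ <| by
    filter_upwards [hl (Filter.eventually_ge_atTop c₀)] with c hc
    exact CStarAlgebra.norm_le_norm_of_nonneg_of_le (hpos c) (sub_le_sub_left (Subtype.coe_le_coe.mpr hc) a)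
  have hre : ∀ y, Filter.Tendsto (fun c : d => (inner ℂ y ((a - (c : H →L[ℂ] H)) y)).re) l
      (nhds (inner ℂ y (R y)).re) := fun y =>
    (Complex.continuous_re.tendsto _).comp (hR y y)
  have hRsa : IsSelfAdjoint R := by
    refine ContinuousLinearMap.ext fun y => ext_inner_left ℂ fun z => ?_
    rw [ContinuousLinearMap.star_eq_adjoint, ContinuousLinearMap.adjoint_inner_right,
      ← inner_conj_symm]
    refine tendsto_nhds_unique ((Complex.continuous_conj.tendsto _).comp (hR y z)) ?_
    convert hR z y using 2 with c
    have hsa := (IsSelfAdjoint.of_nonneg (hpos c)).star_eq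
    rw [Function.comp_apply, inner_conj_symm]
    nth_rw 1 [← hsa]
    rw [ContinuousLinearMap.star_eq_adjoint, ContinuousLinearMap.adjoint_inner_left]
  have hRle : ∀ c : d, R ≤ a - c := fun c => by
    rw [ContinuousLinearMap.le_iff_forall_inner ((IsSelfAdjoint.of_nonneg (hpos c)).sub hRsa)]
    intro y
    rw [sub_apply, inner_sub_right, Complex.sub_re, sub_nonneg]
    refine le_of_tendsto (hre y) ?_
    filter_upwards [hl (Filter.eventually_ge_atTop c)] with c' hc'
    exact re_inner_apply_mono (sub_le_sub_left (Subtype.coe_le_coe.mpr hc') a) y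
  -- R lies below every a - c, so a - R is an upper bound of d and dominates the least one, a.
  have hR0 : R ≤ 0 := by
    have : a ≤ a - R := ha.2 fun c hc => by
      have := hRle ⟨c, hc⟩
      rw [le_sub_comm]; exact this
    simpa using this
  have hx : (inner ℂ x (R x)).re ≤ 0 := by simpa using re_inner_apply_mono hR0 x
  obtain ⟨c, hc⟩ := ((hre x).eventually (gt_mem_nhds (hx.trans_lt hε))).exists
  exact ⟨c, c.2, hc⟩

/-- A positive map is normal if its vector functionals are normal at a total set of vectors. -/
theorem scottContinuous_of_total {A : Type*} [CStarAlgebra A] [PartialOrder A] [StarOrderedRing A]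
    (g : A →ₗ[ℂ] (H →L[ℂ] H)) (hg : ∀ a, 0 ≤ a → 0 ≤ g a) (s : Set H)
    (hs : Dense (Submodule.span ℂ s : Set H))
    (h : ∀ d : Set A, d.Nonempty → DirectedOn (· ≤ ·) d → ∀ a, IsLUB d a → ∀ x ∈ s, ∀ ε : ℝ, 0 < ε →
      ∃ c ∈ d, (inner ℂ x (g (a - c) x)).re < ε) :
    ScottContinuous g := by
  have hmono : ∀ {a b}, a ≤ b → g a ≤ g b := fun {a b} hab => by
    rw [← sub_nonneg, ← map_sub]; exact hg _ (sub_nonneg.mpr hab)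
  intro d hne hd a ha
  refine ⟨?_, fun U hU => ?_⟩
  · rintro _ ⟨c, hc, rfl⟩
    exact hmono (ha.1 hc)
  have key : ∀ x ∈ Submodule.span ℂ s, ∀ ε : ℝ, 0 < ε →
      ∃ c ∈ d, (inner ℂ x (g (a - c) x)).re < ε := by
    intro x hx
    induction hx using Submodule.span_induction with
    | mem x hx => exact h d hne hd a ha x hx
    | zero =>
      intro ε hε
      obtain ⟨c, hc⟩ := hne
      exact ⟨c, hc, by simpa using hε⟩
    | add x y _ _ ihx ihy =>
      intro ε hε
      -- By the parallelogram law and positivity at x - y, the form at x + y is at most twice the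
      -- sum of those at x and y; hence ε / 4.
      obtain ⟨c₁, hc₁, h₁⟩ := ihx (ε / 4) (by positivity)
      obtain ⟨c₂, hc₂, h₂⟩ := ihy (ε / 4) (by positivity)
      obtain ⟨c, hc, hl₁, hl₂⟩ := hd c₁ hc₁ c₂ hc₂
      refine ⟨c, hc, ?_⟩
      have h₁' := re_inner_apply_mono (hmono (sub_le_sub_left hl₁ a)) x
      have h₂' := re_inner_apply_mono (hmono (sub_le_sub_left hl₂ a)) y
      have h₃ := re_inner_apply_nonneg (hg _ (sub_nonneg.mpr (ha.1 hc))) (x - y)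
      simp only [map_sub (g (a - c)), map_add (g (a - c)), inner_add_left, inner_add_right,
        inner_sub_left, inner_sub_right, Complex.add_re, Complex.sub_re] at h₃ ⊢
      linarith
    | smul z x _ ih =>
      intro ε hε
      obtain ⟨c, hc, h₁⟩ := ih (ε / (‖z‖ ^ 2 + 1)) (by positivity)
      refine ⟨c, hc, ?_⟩
      have h₃ := re_inner_apply_nonneg (hg _ (sub_nonneg.mpr (ha.1 hc))) x
      rw [map_smul, inner_smul_left, inner_smul_right, ← mul_assoc, Complex.conj_mul',
        ← Complex.ofReal_pow, Complex.re_ofReal_mul]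
      rw [lt_div_iff₀ (by positivity)] at h₁
      nlinarith [sq_nonneg ‖z‖]
  -- U is an arbitrary upper bound, perhaps not selfadjoint; but U and g a both differ from g c by a
  -- positive operator.
  have hsa : IsSelfAdjoint (U - g a) := by
    obtain ⟨c, hc⟩ := hne
    have h1 : IsSelfAdjoint (U - g c) :=
      IsSelfAdjoint.of_nonneg (sub_nonneg.mpr (hU (Set.mem_image_of_mem _ hc)))
    have h2 : IsSelfAdjoint (g a - g c) :=
      IsSelfAdjoint.of_nonneg (sub_nonneg.mpr (hmono (ha.1 hc)))
    simpa using h1.sub h2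
  rw [ContinuousLinearMap.le_iff_forall_inner hsa]
  intro x
  refine hs.induction (P := fun x => 0 ≤ (inner ℂ x ((U - g a) x)).re) ?_ ?_ x
  · intro y hy
    refine le_of_forall_pos_lt_add fun ε hε => ?_
    obtain ⟨c, hc, hlt⟩ := key y hy ε hε
    have h1 := re_inner_apply_mono (hU (Set.mem_image_of_mem _ hc)) y
    rw [map_sub] at hlt
    simp only [sub_apply, inner_sub_right, Complex.sub_re] at hlt ⊢
    linarith
  · refine isClosed_le continuous_const (Complex.continuous_re.comp ?_)
    fun_prop

theorem scottContinuous_Ad {K : Type*} [NormedAddCommGroup K] [InnerProductSpace ℂ K]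
    [CompleteSpace K] (V : H →L[ℂ] K) : ScottContinuous (Ad V) := by
  obtain ⟨g, hg⟩ := exists_completelyPositiveMap_Ad V
  refine scottContinuous_of_total _ (fun T hT => ?_) Set.univ (by simp) ?_
  · rw [← hg]; exact map_nonneg g hT
  · intro d hne hd a ha x _ ε hε
    obtain ⟨c, hc, h⟩ := exists_re_inner_sub_lt hne hd ha (V x) hε
    exact ⟨c, hc, by rwa [inner_Ad]⟩

theorem isNCP_Ad {K : Type*} [NormedAddCommGroup K] [InnerProductSpace ℂ K]
    [CompleteSpace K] (V : H →L[ℂ] K) : IsNCP (Ad V) :=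
  ⟨exists_completelyPositiveMap_Ad V, scottContinuous_Ad V⟩

/-- Vector functionals of a normal map stay normal after compression by an element. -/
theorem ScottContinuous.exists_re_inner_conj_lt {A : Type*} [CStarAlgebra A] [PartialOrder A]
    [StarOrderedRing A] {f : A →ₗ[ℂ] (H →L[ℂ] H)} (hf : ScottContinuous f) (b : A)
    {d : Set A} (hne : d.Nonempty) (hd : DirectedOn (· ≤ ·) d) {a : A} (ha : IsLUB d a)
    (x : H) {ε : ℝ} (hε : 0 < ε) :
    ∃ c ∈ d, (inner ℂ x (f (star b * (a - c) * b) x)).re < ε := by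
  have hmono : Monotone f := hf.monotone
  have base : ∀ d : Set A, d.Nonempty → DirectedOn (· ≤ ·) d → ∀ a, IsLUB d a → ∀ δ : ℝ, 0 < δ →
      ∃ c ∈ d, (inner ℂ x (f (a - c) x)).re < δ := by
    intro d hne hd a ha δ hδ
    obtain ⟨_, ⟨c, hc, rfl⟩, h⟩ := exists_re_inner_sub_lt (hne.image f)
      (hd.mono_comp (fun _ _ h => hmono h)) (hf hne hd ha) x hδ
    exact ⟨c, hc, by rwa [map_sub]⟩
  -- Conjugation by an invertible element is an order automorphism, so it preserves suprema.
  have unit : ∀ u : Aˣ, ∀ δ : ℝ, 0 < δ →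
      ∃ c ∈ d, (inner ℂ x (f (star (u : A) * (a - c) * u) x)).re < δ := by
    intro u δ hδ
    have hm : ∀ v : A, Monotone fun c => star v * c * v := fun v _ _ h =>
      star_left_conjugate_le_conjugate h v
    obtain ⟨_, ⟨c, hc, rfl⟩, h⟩ := base _ (hne.image fun c => star (u : A) * c * u)
      (hd.mono_comp (fun _ _ h => hm _ h)) (star (u : A) * a * u) (by
        refine ⟨(hm _).mem_upperBounds_image ha.1, fun y hy => ?_⟩
        have hinv : ∀ z : A, star (↑u⁻¹ : A) * (star (u : A) * z * u) * ↑u⁻¹ = z := fun z => by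
          rw [mul_assoc, mul_assoc _ (u : A), Units.mul_inv, mul_one, ← mul_assoc, ← star_mul,
            Units.mul_inv, star_one, one_mul]
        have hinv' : ∀ z : A, star (u : A) * (star (↑u⁻¹ : A) * z * ↑u⁻¹) * u = z := fun z => by
          rw [mul_assoc, mul_assoc _ (↑u⁻¹ : A), Units.inv_mul, mul_one, ← mul_assoc, ← star_mul,
            Units.inv_mul, star_one, one_mul]
        have : a ≤ star (↑u⁻¹ : A) * y * ↑u⁻¹ := ha.2 fun c hc => by
          rw [← hinv c]; exact hm _ (hy (Set.mem_image_of_mem _ hc))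
        rw [← hinv' y]; exact hm _ this) δ hδ
    refine ⟨c, hc, ?_⟩
    rwa [mul_sub, sub_mul]
  -- A large scalar shift makes u = b + r invertible; b = u - r is then recovered by a parallelogram
  -- identity.
  obtain ⟨r, hr⟩ : ∃ r : ℝ, ‖b‖ * ‖(1 : A)‖ < r := exists_gt _
  have hr0 : 0 < r := (by positivity : (0 : ℝ) ≤ ‖b‖ * ‖(1 : A)‖).trans_lt hr
  have hu : IsUnit (b + algebraMap ℝ A r) := by
    have h1 : (-r) ∈ resolventSet ℝ b := by
      refine spectrum.mem_resolventSet_of_norm_lt_mul ?_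
      rwa [norm_neg, Real.norm_of_nonneg hr0.le]
    rw [spectrum.mem_resolventSet_iff] at h1
    rw [← IsUnit.neg_iff]
    simpa [neg_add, sub_eq_add_neg, add_comm] using h1
  obtain ⟨u, hu⟩ := hu
  obtain ⟨c₁, hc₁, h₁⟩ := unit u (ε / 4) (by positivity)
  obtain ⟨c₂, hc₂, h₂⟩ := base d hne hd a ha (ε / (4 * r ^ 2)) (by positivity)
  obtain ⟨c, hc, hl₁, hl₂⟩ := hd c₁ hc₁ c₂ hc₂
  refine ⟨c, hc, ?_⟩
  have h₁' := re_inner_apply_mono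
    (hmono (star_left_conjugate_le_conjugate (sub_le_sub_left hl₁ a) (u : A))) x
  have h₂' := re_inner_apply_mono (hmono (sub_le_sub_left hl₂ a)) x
  have h₃ : 0 ≤ (inner ℂ x (f (star (b + algebraMap ℝ A (2 * r)) * (a - c) *
      (b + algebraMap ℝ A (2 * r))) x)).re := by
    refine re_inner_apply_nonneg ?_ x
    rw [← map_zero f]
    exact hmono (star_left_conjugate_nonneg (sub_nonneg.mpr (ha.1 hc)) _)
  -- With D = a - c: (u - r)⋆D(u - r) = 2u⋆Du + 2r²D - (u + r)⋆D(u + r). The last term is discarded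
  -- by `h₃`; the first two contribute less than ε / 2 each.
  have e : star b * (a - c) * b = ((2 : ℝ) : ℂ) • (star (u : A) * (a - c) * u)
      + ((2 * r ^ 2 : ℝ) : ℂ) • (a - c)
      - star (b + algebraMap ℝ A (2 * r)) * (a - c) * (b + algebraMap ℝ A (2 * r)) := by
    rw [hu]
    generalize a - c = D
    simp only [Complex.coe_smul, Algebra.algebraMap_eq_smul_one, star_add, star_smul, star_one,
      star_trivial, add_mul, mul_add, smul_mul_assoc, mul_smul_comm, one_mul, mul_one]
    module
  rw [e, map_sub, map_add, map_smul, map_smul]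
  simp only [sub_apply, add_apply, smul_apply, inner_sub_right, inner_add_right,
    inner_smul_right, Complex.sub_re, Complex.add_re, Complex.re_ofReal_mul]
  rw [lt_div_iff₀ (by positivity)] at h₂
  nlinarith [mul_le_mul_of_nonneg_left h₂' (sq_nonneg r)]

end Vigier

/-! ### Operators defined or determined on total families. -/

section Total

variable {ι K L M : Type*} [NormedAddCommGroup K] [InnerProductSpace ℂ K]
  [NormedAddCommGroup L] [InnerProductSpace ℂ L] [CompleteSpace L]
  [NormedAddCommGroup M] [InnerProductSpace ℂ M] {u : ι → K}

/-- If the Gram matrix of `v` is dominated by that of the total family `u`, then `u i ↦ v i`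
extends to a bounded operator. -/
theorem exists_clm_of_gram_add (hu : Dense (Submodule.span ℂ (Set.range u) : Set K))
    (v : ι → L) (w : ι → M) (C : ℝ) (hC : 0 ≤ C)
    (h : ∀ i j, inner ℂ (v i) (v j) + inner ℂ (w i) (w j) = (C : ℂ) ^ 2 * inner ℂ (u i) (u j)) :
    ∃ S : K →L[ℂ] L, ∀ i, S (u i) = v i := by
  let e := Finsupp.linearCombination ℂ u
  let f := Finsupp.linearCombination ℂ v
  let g := Finsupp.linearCombination ℂ w
  -- The slack family w turns domination into an identity, which extends sesquilinearly from
  -- generators; an entrywise inequality would not.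
  have key : ∀ ξ η : ι →₀ ℂ, inner ℂ (f ξ) (f η) + inner ℂ (g ξ) (g η) =
      (C : ℂ) ^ 2 * inner ℂ (e ξ) (e η) := by
    intro ξ η
    induction ξ using Finsupp.induction_linear with
    | zero => simp
    | add ξ₁ ξ₂ h₁ h₂ =>
      simp only [map_add, inner_add_left, mul_add, ← h₁, ← h₂]; ring
    | single i a =>
      induction η using Finsupp.induction_linear with
      | zero => simp
      | add η₁ η₂ h₁ h₂ =>
        simp only [map_add, inner_add_right, mul_add, ← h₁, ← h₂]; ring
      | single j b =>
        simp only [e, f, g, Finsupp.linearCombination_single, inner_smul_left, inner_smul_right]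
        linear_combination ((starRingEnd ℂ) a * b) * h i j
  have hbd : ∀ ξ, ‖f ξ‖ ≤ C * ‖e ξ‖ := fun ξ => by
    have h1 := key ξ ξ
    simp only [inner_self_eq_norm_sq_to_K] at h1
    have h2 : ‖f ξ‖ ^ 2 + ‖g ξ‖ ^ 2 = C ^ 2 * ‖e ξ‖ ^ 2 := 
      Complex.ofReal_injective (by push_cast; exact h1)
    refine abs_le_of_sq_le_sq' ?_ (by positivity) |>.2
    nlinarith [sq_nonneg ‖g ξ‖]
  have hd : DenseRange e := by
    have : Set.range e = (Submodule.span ℂ (Set.range u) : Set K) := by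
      rw [← Finsupp.range_linearCombination]; rfl
    rw [DenseRange, this]; exact hu
  refine ⟨f.extendOfNorm e, fun i => ?_⟩
  have := LinearMap.extendOfNorm_eq hd ⟨C, hbd⟩ (Finsupp.single i 1)
  simpa [e, f] using this

theorem exists_clm_of_gram_eq (hu : Dense (Submodule.span ℂ (Set.range u) : Set K))
    (v : ι → L) (h : ∀ i j, inner ℂ (v i) (v j) = (inner ℂ (u i) (u j) : ℂ)) :
    ∃ S : K →L[ℂ] L, ∀ i, S (u i) = v i :=
  exists_clm_of_gram_add hu v (fun _ => (0 : L)) 1 zero_le_one (by simpa using h)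

theorem eq_of_forall_inner_total (hu : Dense (Submodule.span ℂ (Set.range u) : Set K)) {x y : K}
    (h : ∀ i, inner ℂ (u i) x = (inner ℂ (u i) y : ℂ)) : x = y := by
  have : (innerSL ℂ).flip x = (innerSL ℂ).flip y := by
    refine ContinuousLinearMap.ext_on hu ?_
    rintro _ ⟨i, rfl⟩
    exact h i
  exact ext_inner_left ℂ fun z => congrArg (fun F => F z) this

theorem ContinuousLinearMap.eq_of_forall_inner_total
    (hu : Dense (Submodule.span ℂ (Set.range u) : Set K)) {S T : K →L[ℂ] K}
    (h : ∀ i j, inner ℂ (u i) (S (u j)) = (inner ℂ (u i) (T (u j)) : ℂ)) : S = T := by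
  refine ContinuousLinearMap.ext_on hu ?_
  rintro _ ⟨j, rfl⟩
  exact _root_.eq_of_forall_inner_total hu fun i => h i j

end Total

/-! ### Stinespring construction and multiplicative domain. -/

section Dilation

universe v₁ v₂

variable {P : Type v₁} {H : Type v₂} [CStarAlgebra P] [PartialOrder P] [StarOrderedRing P]
  [NormedAddCommGroup H] [InnerProductSpace ℂ H] [CompleteSpace H]

/-- On a finite support the Gram factorisation N turns the quadratic form into ∑ₖ ‖∑ᵢ Nₖᵢ wᵢ‖². -/
theorem CompletelyPositiveMap.posSemidef_kernel (f : CompletelyPositiveMap P (H →L[ℂ] H)) :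
    (Matrix.of fun a b : P => f (star a * b)).PosSemidef := by
  classical
  have tfae := RKHS.posSemidef_tfae (K := Matrix.of fun a b : P => f (star a * b))
  apply (tfae.out 0 2).mpr
  refine ⟨?_, fun vv => ?_⟩
  · ext1 a b
    rw [Matrix.conjTranspose_apply, Matrix.of_apply, Matrix.of_apply, ← map_star, star_mul,
      star_star]
  · obtain ⟨N, hN⟩ := f.exists_gram fun i : vv.support => (i : P)
    have h1 : (vv.sum fun x w => vv.sum fun x' w' =>
        inner ℂ ((Matrix.of fun a b : P => f (star a * b)) x' x w) w') =
        ∑ k, inner ℂ (∑ i : vv.support, N k i (vv i)) (∑ i : vv.support, N k i (vv i)) := by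
      simp only [Finsupp.sum, Matrix.of_apply]
      rw [← Finset.sum_coe_sort]
      simp only [← Finset.sum_coe_sort vv.support, sum_inner, inner_sum, hN, sum_apply,
        mul_apply_eq_comp, ContinuousLinearMap.star_eq_adjoint,
        ContinuousLinearMap.adjoint_inner_left]
      rw [Finset.sum_comm]
      calc _ = ∑ i : vv.support, ∑ k, ∑ j : vv.support,
            inner ℂ (N k j (vv j)) (N k i (vv i)) :=
            Finset.sum_congr rfl fun i _ => Finset.sum_comm
        _ = _ := Finset.sum_comm
    rw [h1, map_sum]
    exact Finset.sum_nonneg fun k _ => inner_self_nonneg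

/-- The Stinespring space of a completely positive map. -/
theorem CompletelyPositiveMap.exists_kernel (f : CompletelyPositiveMap P (H →L[ℂ] H)) :
    ∃ (L : Type (max v₁ v₂)) (_ : NormedAddCommGroup L) (_ : InnerProductSpace ℂ L)
      (_ : CompleteSpace L) (k : P → H →L[ℂ] L),
      (∀ a b x y, inner ℂ (k a x) (k b y) = (inner ℂ x (f (star a * b) y) : ℂ)) ∧
      Dense (Submodule.span ℂ (Set.range fun p : P × H => k p.1 p.2) : Set L) := by
  have : Fact (Matrix.of fun a b : P => f (star a * b)).PosSemidef := ⟨f.posSemidef_kernel⟩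
  refine ⟨RKHS.OfKernel (Matrix.of fun a b : P => f (star a * b)), inferInstance, inferInstance,
    inferInstance, RKHS.kerFun _, fun a b x y => ?_, ?_⟩
  · rw [← RKHS.kernel_inner, RKHS.OfKernel.kernel_ofKernel, Matrix.of_apply,
      ← ContinuousLinearMap.adjoint_inner_right, ← ContinuousLinearMap.star_eq_adjoint,
      ← map_star, star_mul, star_star]
  · have h := RKHS.kerFun_dense (RKHS.OfKernel (Matrix.of fun a b : P => f (star a * b)))
    rw [← Submodule.dense_iff_topologicalClosure_eq_top] at h
    have hs : (Set.range fun p : P × H =>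
        RKHS.kerFun (RKHS.OfKernel (Matrix.of fun a b : P => f (star a * b))) p.1 p.2) =
        {z | ∃ x v, RKHS.kerFun (RKHS.OfKernel (Matrix.of fun a b : P => f (star a * b))) x v
          = z} := by
      ext z; simp
    rw [hs]
    exact h

/-- The Stinespring representation. -/
theorem exists_rep_of_kernel {L : Type*} [NormedAddCommGroup L] [InnerProductSpace ℂ L]
    [CompleteSpace L] (f : CompletelyPositiveMap P (H →L[ℂ] H)) (k : P → H →L[ℂ] L)
    (hk : ∀ a b x y, inner ℂ (k a x) (k b y) = (inner ℂ x (f (star a * b) y) : ℂ))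
    (hd : Dense (Submodule.span ℂ (Set.range fun p : P × H => k p.1 p.2) : Set L)) :
    ∃ π : P →⋆ₐ[ℂ] (L →L[ℂ] L), ∀ c b x, π c (k b x) = k (c * b) x := by
  have hex : ∀ c : P, ∃ T : L →L[ℂ] L, ∀ p : P × H, T (k p.1 p.2) = k (c * p.1) p.2 := by
    intro c
    -- Left multiplication by c is bounded by ‖c‖: writing ‖c‖² - c⋆c = s⋆s, multiplication by s
    -- supplies the slack family.
    obtain ⟨s, hs⟩ := CStarAlgebra.exists_eq_star_mul_self
      (sub_nonneg.mpr (CStarAlgebra.star_mul_le_algebraMap_norm_sq (a := c)))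
    refine exists_clm_of_gram_add hd (fun p => k (c * p.1) p.2) (fun p => k (s * p.1) p.2) ‖c‖
      (norm_nonneg c) fun p q => ?_
    have e : ∀ t : P, star (t * p.1) * (t * q.1) = star p.1 * (star t * t) * q.1 := fun t => by
      simp only [star_mul, mul_assoc]
    rw [hk, hk, hk, ← inner_add_right, ← add_apply, ← map_add, e, e, ← hs, ← add_mul, ← mul_add,
      add_sub_cancel, Algebra.algebraMap_eq_smul_one, ← Complex.coe_smul, mul_smul_comm, mul_one,
      smul_mul_assoc, map_smul, smul_apply, inner_smul_right, Complex.ofReal_pow]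
  choose T hT using hex
  have hT' : ∀ c b x, T c (k b x) = k (c * b) x := fun c b x => hT c (b, x)
  have hext : ∀ {R S : L →L[ℂ] L}, (∀ a b x y, inner ℂ (k a x) (R (k b y)) =
      (inner ℂ (k a x) (S (k b y)) : ℂ)) → R = S := fun {R S} h =>
    ContinuousLinearMap.eq_of_forall_inner_total hd fun i j => h _ _ _ _
  refine ⟨{ toFun := T
            map_one' := hext fun a b x y => ?_
            map_mul' := fun c d => hext fun a b x y => ?_
            map_zero' := hext fun a b x y => ?_
            map_add' := fun c d => hext fun a b x y => ?_
            commutes' := fun r => hext fun a b x y => ?_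
            map_star' := fun c => hext fun a b x y => ?_ }, hT'⟩
  · rw [hT', one_mul, one_apply_eq_self]
  · rw [hT', mul_apply_eq_comp, hT', hT', mul_assoc]
  · rw [hT', hk]; simp
  · rw [add_apply, inner_add_right, hT', hT', hT', hk, hk, hk, add_mul, mul_add, map_add,
      add_apply, inner_add_right]
  · rw [hT', Algebra.algebraMap_eq_smul_one, Algebra.algebraMap_eq_smul_one, hk, smul_apply,
      one_apply_eq_self, inner_smul_right, hk, smul_mul_assoc, one_mul, mul_smul_comm, map_smul,
      smul_apply, inner_smul_right]
  · rw [ContinuousLinearMap.star_eq_adjoint, ContinuousLinearMap.adjoint_inner_right, hT', hT',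
      hk, hk, star_mul, mul_assoc]

/-- At a vector k(b)x the functional of π is c ↦ ⟨x, f(b⋆cb)x⟩, and these vectors are total. -/
theorem scottContinuous_rep_of_kernel {L : Type*} [NormedAddCommGroup L] [InnerProductSpace ℂ L]
    [CompleteSpace L] (f : CompletelyPositiveMap P (H →L[ℂ] H))
    (hf : ScottContinuous f.toLinearMap) (k : P → H →L[ℂ] L)
    (hk : ∀ a b x y, inner ℂ (k a x) (k b y) = (inner ℂ x (f (star a * b) y) : ℂ))
    (hd : Dense (Submodule.span ℂ (Set.range fun p : P × H => k p.1 p.2) : Set L))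
    (π : P →⋆ₐ[ℂ] (L →L[ℂ] L)) (hπ : ∀ c b x, π c (k b x) = k (c * b) x) :
    ScottContinuous π := by
  refine scottContinuous_of_total (π : P →ₗ[ℂ] (L →L[ℂ] L)) (fun a ha => map_nonneg π ha) _ hd ?_
  rintro d hne hdir a ha _ ⟨⟨b, x⟩, rfl⟩ ε hε
  obtain ⟨c, hc, h⟩ := hf.exists_re_inner_conj_lt b hne hdir ha x hε
  refine ⟨c, hc, ?_⟩
  change (inner ℂ (k b x) (π (a - c) (k b x))).re < ε
  rw [hπ, hk, ← mul_assoc]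
  exact h

/-- The multiplicative domain of a completely positive map. -/
theorem CompletelyPositiveMap.map_mul_of_map_star_mul_self
    (f : CompletelyPositiveMap P (H →L[ℂ] H)) (h1 : f 1 = 1) {b : P}
    (hb : f (star b * b) = star (f b) * f b) (c : P) : f (c * b) = f c * f b := by
  obtain ⟨L, _, _, _, k, hk, -⟩ := f.exists_kernel
  -- Equality in Kadison–Schwarz says exactly that ‖k(b)w - k(1)f(b)w‖² vanishes.
  have key : ∀ w, k b w = k 1 (f b w) := fun w => by
    have hbb : inner ℂ (k b w) (k b w) = (inner ℂ (f b w) (f b w) : ℂ) := by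
      rw [hk, hb, mul_apply_eq_comp, ContinuousLinearMap.star_eq_adjoint,
        ContinuousLinearMap.adjoint_inner_right]
    have h1b : inner ℂ (k 1 (f b w)) (k b w) = (inner ℂ (f b w) (f b w) : ℂ) := by
      rw [hk, star_one, one_mul]
    have hb1 : inner ℂ (k b w) (k 1 (f b w)) = (inner ℂ (f b w) (f b w) : ℂ) := by
      rw [← inner_conj_symm, h1b, inner_conj_symm]
    have h11 : inner ℂ (k 1 (f b w)) (k 1 (f b w)) = (inner ℂ (f b w) (f b w) : ℂ) := by
      rw [hk, star_one, one_mul, h1, one_apply_eq_self]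
    rw [← sub_eq_zero, ← inner_self_eq_zero (𝕜 := ℂ), inner_sub_left, inner_sub_right,
      inner_sub_right, hbb, h1b, hb1, h11]
    ring
  refine ContinuousLinearMap.ext fun w => ext_inner_left ℂ fun v => ?_
  have h2 := hk (star c) b v w
  rw [key, hk, star_star, mul_one] at h2
  rw [← h2, mul_apply_eq_comp]

end Dilation

/-! ### NCP-maps and multiplicativity of invertible ones. -/

section Main

variable {A B C : Type*} [CStarAlgebra A] [PartialOrder A] [StarOrderedRing A]
  [CStarAlgebra B] [PartialOrder B] [StarOrderedRing B]
  [CStarAlgebra C] [PartialOrder C] [StarOrderedRing C]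

theorem IsNCP.comp {g : B →ₗ[ℂ] C} {f : A →ₗ[ℂ] B} (hg : IsNCP g) (hf : IsNCP f) :
    IsNCP (g ∘ₗ f) := by
  obtain ⟨⟨g', rfl⟩, hgn⟩ := hg
  obtain ⟨⟨f', rfl⟩, hfn⟩ := hf
  exact ⟨⟨⟨g'.toLinearMap ∘ₗ f'.toLinearMap, fun k M hM =>
    g'.map_cstarMatrix_nonneg' k _ (f'.map_cstarMatrix_nonneg' k M hM)⟩, rfl⟩, hfn.comp hgn⟩

theorem IsNCP.of_starAlgHom (π : A →⋆ₐ[ℂ] B) (hπ : ScottContinuous π) :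
    IsNCP (π : A →ₗ[ℂ] B) :=
  ⟨⟨⟨(π : A →ₗ[ℂ] B), fun k M hM =>
    CompletelyPositiveMapClass.map_cstarMatrix_nonneg' π k M hM⟩, rfl⟩, hπ⟩

theorem IsNCP.id : IsNCP (LinearMap.id : A →ₗ[ℂ] A) :=
  IsNCP.of_starAlgHom (StarAlgHom.id ℂ A) ScottContinuous.id

omit [PartialOrder A] [StarOrderedRing A] in
theorem CStarAlgebra.four_smul_star_mul (x y : A) : (4 : ℂ) • (star x * y) =
    star (x + y) * (x + y) - star (x - y) * (x - y)
      - Complex.I • (star (x + Complex.I • y) * (x + Complex.I • y))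
      + Complex.I • (star (x - Complex.I • y) * (x - Complex.I • y)) := by
  simp only [star_add, star_sub, star_smul, RCLike.star_def, Complex.conj_I, add_mul, sub_mul,
    mul_add, mul_sub, smul_mul_assoc, mul_smul_comm, smul_add, smul_sub, smul_smul, neg_smul,
    smul_neg, neg_mul, Complex.I_mul_I, one_smul, neg_neg]
  module

/-- Mutually inverse unital completely positive maps are multiplicative. -/
theorem CompletelyPositiveMap.map_mul_of_leftInverse (f : CompletelyPositiveMap A B)
    (g : CompletelyPositiveMap B A) (hf : f 1 = 1) (hg : g 1 = 1) (hgf : ∀ a, g (f a) = a)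
    (hfg : ∀ b, f (g b) = b) (a b : A) : f (a * b) = f a * f b := by
  -- Kadison–Schwarz for g at f a, pushed forward by f, is the reverse of Kadison–Schwarz for f;
  -- polarization does the rest.
  have hsq : ∀ a, f (star a * a) = star (f a) * f a := fun a => by
    refine le_antisymm ?_ (f.star_map_mul_map_le hf a)
    have h := g.star_map_mul_map_le hg (f a)
    rw [hgf] at h
    have h' := (OrderHomClass.mono f : Monotone f) h
    rwa [hfg] at h'
  have h4 : (4 : ℂ) • f (star (star a) * b) = (4 : ℂ) • (star (f (star a)) * f b) := by
    rw [← map_smul, CStarAlgebra.four_smul_star_mul, CStarAlgebra.four_smul_star_mul]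
    simp only [map_add, map_sub, map_smul, hsq]
  have := smul_right_injective B (by norm_num : (4 : ℂ) ≠ 0) h4
  rwa [star_star, ← map_star, star_star] at this

end Main

/-! ### The universal property of a minimal Stinespring dilation. -/

section Universal

variable {A : Type*} [CStarAlgebra A] [PartialOrder A]
  {H K : Type*} [NormedAddCommGroup H] [InnerProductSpace ℂ H] [CompleteSpace H]
  [NormedAddCommGroup K] [InnerProductSpace ℂ K] [CompleteSpace K]
  {φ : A →ₗ[ℂ] (H →L[ℂ] H)} {π : A →⋆ₐ[ℂ] (K →L[ℂ] K)} {V : H →L[ℂ] K}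

theorem IsMinimalNormalStinespringDilation.dense_span_range
    (hV : IsMinimalNormalStinespringDilation φ π V) :
    Dense (Submodule.span ℂ (Set.range fun p : A × H => π p.1 (V p.2)) : Set K) := by
  have h := hV.dense_span
  have e : {y : K | ∃ (a : A) (x : H), y = π a (V x)} =
      Set.range fun p : A × H => π p.1 (V p.2) := by
    ext y; simp [eq_comm]
  rwa [e] at h

theorem IsMinimalNormalStinespringDilation.inner_apply
    (hV : IsMinimalNormalStinespringDilation φ π V) (a b : A) (x y : H) :
    inner ℂ (π a (V x)) (π b (V y)) = (inner ℂ x (φ (star a * b) y) : ℂ) := by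
  rw [hV.factor, inner_Ad, map_mul, map_star, mul_apply_eq_comp,
    ContinuousLinearMap.star_eq_adjoint, ContinuousLinearMap.adjoint_inner_right]

theorem IsMinimalNormalStinespringDilation.exists_mediating
    (hV : IsMinimalNormalStinespringDilation φ π V) {P : Type*} [CStarAlgebra P]
    [PartialOrder P] [StarOrderedRing P] (ρ : A →⋆ₐ[ℂ] P) (f : P →ₗ[ℂ] (H →L[ℂ] H))
    (hf : IsNCP f) (hφ : ∀ a, φ a = f (ρ a)) :
    ∃ σ : P →ₗ[ℂ] (K →L[ℂ] K), IsNCP σ ∧ (∀ a, σ (ρ a) = π a) ∧ ∀ c, Ad V (σ c) = f c := by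
  obtain ⟨⟨f', rfl⟩, hfn⟩ := hf
  have hφ' : ∀ a, φ a = f' (ρ a) := hφ
  obtain ⟨L, _, _, _, k, hk, hd⟩ := f'.exists_kernel
  obtain ⟨τ, hτ⟩ := exists_rep_of_kernel f' k hk hd
  have hτn := scottContinuous_rep_of_kernel f' hfn k hk hd τ hτ
  obtain ⟨S, hS⟩ := exists_clm_of_gram_eq hV.dense_span_range
    (fun p : A × H => k (ρ p.1) p.2) fun p q => by
      rw [hk, hV.inner_apply, hφ', map_mul ρ, map_star ρ]
  have hS' : ∀ a x, S (π a (V x)) = k (ρ a) x := fun a x => hS (a, x)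
  have hSV : ∀ x, S (V x) = k 1 x := fun x => by
    have := hS' 1 x
    rwa [map_one, map_one, one_apply_eq_self] at this
  refine ⟨Ad S ∘ₗ (τ : P →ₗ[ℂ] (L →L[ℂ] L)), (isNCP_Ad S).comp (.of_starAlgHom τ hτn),
    fun a => ?_, fun c => ?_⟩
  · refine ContinuousLinearMap.eq_of_forall_inner_total hV.dense_span_range ?_
    rintro ⟨b, x⟩ ⟨c, y⟩
    change inner ℂ (π b (V x)) (Ad S (τ (ρ a)) (π c (V y))) =
      (inner ℂ (π b (V x)) (π a (π c (V y))) : ℂ)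
    rw [inner_Ad, hS', hS', hτ, hk, ← mul_apply_eq_comp, ← map_mul π, hV.inner_apply, hφ',
      map_mul ρ, map_star ρ, map_mul ρ]
  · refine ContinuousLinearMap.ext fun x => ext_inner_left ℂ fun y => ?_
    change inner ℂ y (Ad V (Ad S (τ c)) x) = (inner ℂ y (f' c x) : ℂ)
    rw [inner_Ad, inner_Ad, hSV, hSV, hτ, hk, star_one, one_mul, mul_one]

omit [PartialOrder A] in
-- The right side does not involve σ, so this pins σ down on a total family. It holds because σ is a
-- bimodule map over ρ(A), which lies in its multiplicative domain.
theorem IsNCP.inner_mediating {P : Type*} [CStarAlgebra P]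
    [PartialOrder P] [StarOrderedRing P] (ρ : A →⋆ₐ[ℂ] P) (f : P →ₗ[ℂ] (H →L[ℂ] H))
    {σ : P →ₗ[ℂ] (K →L[ℂ] K)} (hσ : IsNCP σ) (hρ : ∀ a, σ (ρ a) = π a)
    (hf : ∀ c, Ad V (σ c) = f c) (a b : A) (c : P) (x y : H) :
    inner ℂ (π a (V x)) (σ c (π b (V y))) =
      (inner ℂ x (f (ρ (star a) * (c * ρ b)) y) : ℂ) := by
  obtain ⟨⟨s, rfl⟩, -⟩ := hσ
  have hρ' : ∀ a, s (ρ a) = π a := hρ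
  have h1 : s 1 = 1 := by
    have := hρ' 1
    rwa [map_one ρ, map_one π] at this
  have hright : ∀ (b : A) (c : P), s (c * ρ b) = s c * π b := fun b c => by
    rw [← hρ' b]
    refine s.map_mul_of_map_star_mul_self h1 ?_ c
    rw [← map_star, ← map_mul, hρ', hρ', map_mul, map_star]
  -- The left-handed version follows from the right-handed one by taking adjoints.
  have hleft : s (ρ (star a) * (c * ρ b)) = star (π a) * (s c * π b) := by
    rw [← hright, ← star_inj, ← map_star, map_star ρ, star_mul, star_star, hright, map_star,
      star_mul, star_star]
  have : f (ρ (star a) * (c * ρ b)) = Ad V (star (π a) * (s c * π b)) := by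
    rw [← hf, ← hleft]; rfl
  rw [this, inner_Ad, mul_apply_eq_comp, mul_apply_eq_comp, ContinuousLinearMap.star_eq_adjoint,
    ContinuousLinearMap.adjoint_inner_right]
  rfl

theorem IsMinimalNormalStinespringDilation.isPaschkeDilation [StarOrderedRing A] [WStarAlgebra A]
    (hV : IsMinimalNormalStinespringDilation φ π V) : IsPaschkeDilation φ π (Ad V) where
  nmiu := hV.nmiu
  ncp := isNCP_Ad V
  factor := hV.factor
  universal P' _ _ _ _ ρ' f' _ hf' hφ' := by
    obtain ⟨σ, hσ, h1, h2⟩ := hV.exists_mediating ρ' f' hf' hφ'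
    refine ⟨σ, ⟨hσ, h1, h2⟩, fun σ' h' => LinearMap.ext fun c => ?_⟩
    refine ContinuousLinearMap.eq_of_forall_inner_total hV.dense_span_range ?_
    rintro ⟨a, x⟩ ⟨b, y⟩
    exact (h'.1.inner_mediating ρ' f' h'.2.1 h'.2.2 a b c x y).trans
      (hσ.inner_mediating ρ' f' h1 h2 a b c x y).symm

end Universal

/-! ### Uniqueness of Paschke dilations. -/

section Uniqueness

universe u v₁ v₂

variable {A : Type v₁} {B : Type v₂} [CStarAlgebra A] [PartialOrder A] [StarOrderedRing A]
  [WStarAlgebra A] [CStarAlgebra B] [PartialOrder B] [StarOrderedRing B] [WStarAlgebra B]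
  {P Q : Type u} [CStarAlgebra P] [PartialOrder P] [StarOrderedRing P] [WStarAlgebra P]
  [CStarAlgebra Q] [PartialOrder Q] [StarOrderedRing Q] [WStarAlgebra Q]
  {φ : A →ₗ[ℂ] B} {ρ : A →⋆ₐ[ℂ] P} {f : P →ₗ[ℂ] B} {ρ' : A →⋆ₐ[ℂ] Q} {f' : Q →ₗ[ℂ] B}

omit [WStarAlgebra P] [WStarAlgebra Q] in
theorem IsNCP.of_starAlgEquiv (e : P ≃⋆ₐ[ℂ] Q) (he : ScottContinuous e) :
    IsNCP ((e : P →⋆ₐ[ℂ] Q) : P →ₗ[ℂ] Q) :=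
  .of_starAlgHom (e : P →⋆ₐ[ℂ] Q) he

/-- Paschke dilations are unique up to a unique normal isomorphism. -/
theorem IsPaschkeDilation.existsUnique_starAlgEquiv (h : IsPaschkeDilation.{u} φ ρ f)
    (h' : IsPaschkeDilation.{u} φ ρ' f') :
    ∃! e : P ≃⋆ₐ[ℂ] Q, (ScottContinuous e ∧ ScottContinuous e.symm) ∧
      (∀ a, ρ' a = e (ρ a)) ∧ ∀ c, f' (e c) = f c := by
  obtain ⟨s, ⟨hs, hs1, hs2⟩, hsu⟩ := h'.universal P ρ f h.nmiu h.ncp h.factor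
  obtain ⟨t, ⟨ht, ht1, ht2⟩, -⟩ := h.universal Q ρ' f' h'.nmiu h'.ncp h'.factor
  -- Testing a dilation against itself, the composite and the identity both mediate.
  have hts : t ∘ₗ s = LinearMap.id :=
    (h.universal P ρ f h.nmiu h.ncp h.factor).unique
      ⟨ht.comp hs, fun a => by simp [hs1, ht1], fun c => by simp [hs2, ht2]⟩
      ⟨.id, fun a => rfl, fun c => rfl⟩
  have hst : s ∘ₗ t = LinearMap.id :=
    (h'.universal Q ρ' f' h'.nmiu h'.ncp h'.factor).unique
      ⟨hs.comp ht, fun a => by simp [hs1, ht1], fun c => by simp [hs2, ht2]⟩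
      ⟨.id, fun a => rfl, fun c => rfl⟩
  obtain ⟨⟨s', rfl⟩, hsn⟩ := hs
  obtain ⟨⟨t', rfl⟩, htn⟩ := ht
  have hts' : ∀ c, t' (s' c) = c := fun c => congrArg (fun F => F c) hts
  have hst' : ∀ c, s' (t' c) = c := fun c => congrArg (fun F => F c) hst
  have hs1' : s' 1 = 1 := by
    have : s' (ρ 1) = ρ' 1 := hs1 1
    rwa [map_one ρ, map_one ρ'] at this
  have ht1' : t' 1 = 1 := by rw [← hts' 1, hs1']
  let e : P ≃⋆ₐ[ℂ] Q :=
    { toFun := s'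
      invFun := t'
      left_inv := hts'
      right_inv := hst'
      map_mul' := s'.map_mul_of_leftInverse t' hs1' ht1' hts' hst'
      map_add' := map_add s'
      map_star' := map_star s'
      map_smul' := map_smul s' }
  refine ⟨e, ⟨⟨hsn, htn⟩, fun a => (hs1 a).symm, hs2⟩, ?_⟩
  rintro e' ⟨⟨he', -⟩, h1, h2⟩
  have := hsu _ ⟨IsNCP.of_starAlgEquiv e' he', fun a => (h1 a).symm, h2⟩
  exact StarAlgEquiv.ext fun c => congrArg (fun F => F c) this

end Uniqueness

/-- P shares the universe of B(K), so that each of the two dilations can serve as a test object for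
the other. -/
theorem mainTheorem2 {A : Type u₁} {H : Type u₂} {K : Type u₃}
    [CStarAlgebra A] [PartialOrder A] [StarOrderedRing A] [WStarAlgebra A]
    [NormedAddCommGroup H] [InnerProductSpace ℂ H] [CompleteSpace H]
    [NormedAddCommGroup K] [InnerProductSpace ℂ K] [CompleteSpace K]
    (φ : A →ₗ[ℂ] (H →L[ℂ] H)) (hφ : IsNCP φ)
    (π : A →⋆ₐ[ℂ] (K →L[ℂ] K)) (V : H →L[ℂ] K)
    (hV : IsMinimalNormalStinespringDilation φ π V) :
    IsPaschkeDilation.{w} φ π (Ad V) ∧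
      ∀ (P : Type u₃) [CStarAlgebra P] [PartialOrder P] [StarOrderedRing P] [WStarAlgebra P]
        (ρ : A →⋆ₐ[ℂ] P) (f : P →ₗ[ℂ] (H →L[ℂ] H)),
        IsPaschkeDilation.{u₃} φ ρ f →
          ∃! ϑ : (K →L[ℂ] K) ≃⋆ₐ[ℂ] P,
            (ScottContinuous ϑ ∧ ScottContinuous ϑ.symm) ∧
              (∀ a, ρ a = ϑ (π a)) ∧ ∀ T, f (ϑ T) = Ad V T :=
  ⟨hV.isPaschkeDilation, fun _ _ _ _ _ _ _ h => hV.isPaschkeDilation.existsUnique_starAlgEquiv h⟩
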